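/- For $n\ge 2$, let $UB_n$ (the universal braid group) be the group with generators $\sigma_1,\dots,\sigma_{n-1},\tau_1,\dots,\tau_{n-1}$ and defining relations $$\sigma_i\sigma_{i+1}\sigma_i=\sigma_{i+1}\sigma_i\sigma_{i+1}\quad(1\le i\le n-2),$$ $$\sigma_i\sigma_j=\sigma_j\sigma_i,\qquad \tau_i\tau_j=\tau_j\tau_i,\qquad \tau_i\sigma_j=\sigma_j\tau_i\qquad(|i-j|\ge 2),$$ and let $UP_n$ (the universal pure braid group) be the kernel of the homomorphism $\pi\colon UB_n\to S_n$ given by $\pi(\sigma_i)=\pi(\tau_i)=(i,\,i+1)$ for $1\le i\le n-1$. Then: 1. $UB_3$ is linear, i.e. there are an integer $m\ge 2$, a field $k$ and an injective homomorphism $UB_3\to \mathrm{GL}_m(k)$. 2. $UP_3$ is residually nilpotent, i.e. for every $g\in UP_3$ with $g\neq 1$ there is a normal subgroup $N$ of $UP_3$ such that $g\notin N$ and $UP_3/N$ is nilpotent. -/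

import Mathlib

/-- A group is linear if it has a faithful representation in `GL_m(k)` for some integer `m ≥ 2`
and some field `k`. Taking `k` in the universe of `G` is no restriction, since the entries of the
matrices generate a subfield of cardinality at most `max |G| ℵ₀`. -/
def IsLinearGroup.{u} (G : Type u) [Group G] : Prop :=
  ∃ (m : ℕ) (k : Type u) (_ : Field k), 2 ≤ m ∧
    ∃ f : G →* Matrix.GeneralLinearGroup (Fin m) k, Function.Injective f

/-- A group is residually nilpotent if every nontrivial element survives in some nilpotent
quotient. -/
def IsResiduallyNilpotent (G : Type*) [Group G] : Prop :=
  ∀ g : G, g ≠ 1 → ∃ (N : Subgroup G) (_ : N.Normal), Group.IsNilpotent (G ⧸ N) ∧ g ∉ N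

namespace UniversalBraid

/-- The generators `σ_1, …, σ_{n-1}, τ_1, …, τ_{n-1}`, with indices starting at `0`. -/
inductive Gen (n : ℕ) : Type
  | sigma (i : Fin (n - 1)) : Gen n
  | tau (i : Fin (n - 1)) : Gen n

/-- Two indices at distance at least two. -/
def Far {n : ℕ} (i j : Fin (n - 1)) : Prop :=
  (i : ℕ) + 2 ≤ j ∨ (j : ℕ) + 2 ≤ i

/-- The letter `σ_i` in the free group. -/
def s {n : ℕ} (i : Fin (n - 1)) : FreeGroup (Gen n) := FreeGroup.of (Gen.sigma i)

/-- The letter `τ_i` in the free group. -/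
def t {n : ℕ} (i : Fin (n - 1)) : FreeGroup (Gen n) := FreeGroup.of (Gen.tau i)

/-- The relators of the universal braid group; a relation `u = v` is the relator `u * v⁻¹`. -/
inductive IsRelator (n : ℕ) : FreeGroup (Gen n) → Prop
  | braid (i j : Fin (n - 1)) (h : (j : ℕ) = i + 1) :
      IsRelator n ((s i * s j * s i) * (s j * s i * s j)⁻¹)
  | sigma_comm (i j : Fin (n - 1)) (h : Far i j) :
      IsRelator n ((s i * s j) * (s j * s i)⁻¹)
  | tau_comm (i j : Fin (n - 1)) (h : Far i j) :
      IsRelator n ((t i * t j) * (t j * t i)⁻¹)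
  | mixed_comm (i j : Fin (n - 1)) (h : Far i j) :
      IsRelator n ((t i * s j) * (s j * t i)⁻¹)

/-- The universal braid group `UB_n`. -/
abbrev UB (n : ℕ) : Type := PresentedGroup {r : FreeGroup (Gen n) | IsRelator n r}

/-- The transposition of the neighbouring strands `i` and `i + 1`. -/
def adjSwap {n : ℕ} (i : Fin (n - 1)) : Equiv.Perm (Fin n) :=
  Equiv.swap ⟨i, by have := i.isLt; omega⟩ ⟨i + 1, by have := i.isLt; omega⟩

/-- `π` on generators: both `σ_i` and `τ_i` go to the transposition `(i, i + 1)`. -/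
def genPerm {n : ℕ} : Gen n → Equiv.Perm (Fin n)
  | Gen.sigma i => adjSwap i
  | Gen.tau i => adjSwap i

theorem adjSwap_comm {n : ℕ} (i j : Fin (n - 1)) (h : Far i j) :
    adjSwap i * adjSwap j = adjSwap j * adjSwap i := by
  apply Equiv.Perm.Disjoint.commute
  intro x
  unfold Far at h
  by_cases hx : (x : ℕ) = i ∨ (x : ℕ) = i + 1
  · right
    apply Equiv.swap_apply_of_ne_of_ne <;> rw [Ne, Fin.ext_iff] <;> simp only <;> omega
  · left
    apply Equiv.swap_apply_of_ne_of_ne <;> rw [Ne, Fin.ext_iff] <;> simp only <;> omega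

theorem adjSwap_braid {n : ℕ} (i j : Fin (n - 1)) (h : (j : ℕ) = i + 1) :
    adjSwap i * adjSwap j * adjSwap i = adjSwap j * adjSwap i * adjSwap j := by
  have hj := j.isLt
  have e : adjSwap j =
      Equiv.swap (⟨i + 1, by omega⟩ : Fin n) ⟨i + 2, by omega⟩ := by
    simp only [adjSwap, h]
  rw [e, adjSwap]
  rw [Equiv.swap_mul_swap_mul_swap (by simp [Fin.ext_iff]) (by simp [Fin.ext_iff])]
  rw [Equiv.swap_comm (⟨i, _⟩ : Fin n), Equiv.swap_comm (⟨i + 1, _⟩ : Fin n) ⟨i + 2, _⟩]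
  rw [Equiv.swap_mul_swap_mul_swap (by simp [Fin.ext_iff]) (by simp [Fin.ext_iff])]
  exact Equiv.swap_comm _ _

theorem genPerm_relator {n : ℕ} :
    ∀ r ∈ {r : FreeGroup (Gen n) | IsRelator n r}, FreeGroup.lift genPerm r = 1 := by
  rintro _ (⟨i, j, h⟩ | ⟨i, j, h⟩ | ⟨i, j, h⟩ | ⟨i, j, h⟩) <;>
    rw [map_mul, map_inv, mul_inv_eq_one] <;>
    simp only [s, t, map_mul, FreeGroup.lift_apply_of, genPerm]
  · exact adjSwap_braid i j h
  all_goals exact adjSwap_comm i j h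

/-- The homomorphism `π : UB_n → S_n`, `σ_i, τ_i ↦ (i, i + 1)`. -/
def toPerm (n : ℕ) : UB n →* Equiv.Perm (Fin n) :=
  PresentedGroup.toGroup genPerm_relator

/-- The universal pure braid group `UP_n = ker π`. -/
def UP (n : ℕ) : Subgroup (UB n) := (toPerm n).ker

end UniversalBraid

/-! With x_i = σ_i⁻¹τ_i, the group `UB 3` is generated by the subgroup B of the σ_i and by x_0, x_1,
which satisfy no relations with B or each other. Over L = ℤ[t,t⁻¹], let B act by the 3×3 Burau
representation ρ and send x_i to the transvection 1 + y u_i v_iᵀ over L[z][y], where v_iᵀu_i = 0.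

In the image of a reduced word, the top coefficient in y is of the form u_i rᵀ, up to a product of
nonzero integers and pairings v_iᵀρ(g)u_j. The exponents of z in u_i, v_i are sparse enough that
such a pairing vanishes only if i = j and ρ(g) = 1 (`eq_zero_of_generic_pairing_eq_zero`,
`eq_one_of_generic_pairing_eq_zero`). As ρ is faithful on B, already at t = -2
(`eq_one_of_reducedBurau_eq_one`), the whole representation is faithful (`extendedBurau_injective`).
Passing to the fraction field gives linearity.

At t = 1, y = 0 the representation becomes the permutation representation through π
(`map_genericRep`). So `UP 3` embeds in matrices congruent to 1 modulo a proper ideal I of a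
noetherian domain. Its lower central series lies in the congruence subgroups of the powers of I,
whose intersection is trivial by Krull. -/

namespace UniversalBraid

/-! ### Reduced words over a subgroup and extra generators -/

section Syllables

variable {G ι : Type*} [Group G]

/-- `ReducedFrom B x i w` says that `w` is an alternating product of nonzero powers of the `x j`
and elements of `B` that starts with a power of `x i` and in which no two successive powers can be
merged. -/
inductive ReducedFrom (B : Subgroup G) (x : ι → G) : ι → G → Prop
  | single (i : ι) (m : ℤ) (g : G) (hm : m ≠ 0) (hg : g ∈ B) : ReducedFrom B x i (x i ^ m * g)
  | cons (i j : ι) (m : ℤ) (g w : G) (hm : m ≠ 0) (hg : g ∈ B) (hij : i = j → g ≠ 1)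
      (hw : ReducedFrom B x j w) : ReducedFrom B x i (x i ^ m * (g * w))

/-- Elements of `B`, and reduced words multiplied by an element of `B` from the left. -/
def HasReducedForm (B : Subgroup G) (x : ι → G) (w : G) : Prop :=
  w ∈ B ∨ ∃ g ∈ B, ∃ i w', ReducedFrom B x i w' ∧ w = g * w'

variable {B : Subgroup G} {x : ι → G}

theorem ReducedFrom.hasReducedForm {i : ι} {w : G} (h : ReducedFrom B x i w) :
    HasReducedForm B x w :=
  Or.inr ⟨1, B.one_mem, i, w, h, (one_mul w).symm⟩

theorem HasReducedForm.mem_mul {w g : G} (h : HasReducedForm B x w) (hg : g ∈ B) :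
    HasReducedForm B x (g * w) := by
  rcases h with h | ⟨g', hg', i, w', hw', rfl⟩
  · exact Or.inl (B.mul_mem hg h)
  · exact Or.inr ⟨g * g', B.mul_mem hg hg', i, w', hw', (mul_assoc _ _ _).symm⟩

/-- Only a leading power of the same generator with trivial separator obstructs reducedness. The two
powers then merge, and if they cancel, the remaining tail is already in the required form. -/
theorem HasReducedForm.zpow_mul {w : G} (h : HasReducedForm B x w) (i : ι) (n : ℤ) :
    HasReducedForm B x (x i ^ n * w) := by
  rcases eq_or_ne n 0 with rfl | hn
  · simpa using h
  rcases h with h | ⟨g, hg, j, w', hw', rfl⟩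
  · exact (ReducedFrom.single i n w hn h).hasReducedForm
  by_cases hij : i = j → g ≠ 1
  · exact (ReducedFrom.cons i j n g w' hn hg hij hw').hasReducedForm
  · push Not at hij
    obtain ⟨rfl, rfl⟩ := hij
    rw [one_mul]
    cases hw' with
    | single _ m g hm hg =>
      rw [← mul_assoc, ← zpow_add]
      rcases eq_or_ne (n + m) 0 with h0 | h0
      · rw [h0, zpow_zero, one_mul]
        exact Or.inl hg
      · exact (ReducedFrom.single i _ g h0 hg).hasReducedForm
    | cons _ k m g w hm hg hik hw =>
      rw [← mul_assoc, ← zpow_add]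
      rcases eq_or_ne (n + m) 0 with h0 | h0
      · rw [h0, zpow_zero, one_mul]
        exact Or.inr ⟨g, hg, k, w, hw, rfl⟩
      · exact (ReducedFrom.cons i k _ g w h0 hg hik hw).hasReducedForm

/-- Existence suffices: uniqueness of the form is never needed, since the representation itself
detects reduced words. -/
theorem hasReducedForm_of_closure_eq_top
    (h : Subgroup.closure ((B : Set G) ∪ Set.range x) = ⊤) (w : G) : HasReducedForm B x w := by
  have hw : w ∈ Subgroup.closure ((B : Set G) ∪ Set.range x) := h ▸ Subgroup.mem_top w
  induction hw using Subgroup.closure_induction_left with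
  | one => exact Or.inl B.one_mem
  | mul_left a ha y hy ih =>
    rcases ha with ha | ⟨i, rfl⟩
    · exact ih.mem_mul ha
    · simpa using ih.zpow_mul i 1
  | inv_mul_cancel a ha y hy ih =>
    rcases ha with ha | ⟨i, rfl⟩
    · exact ih.mem_mul (B.inv_mem ha)
    · simpa using ih.zpow_mul i (-1)

end Syllables

/-! ### Congruence subgroups and residual nilpotence -/

section Congruence

open Matrix
open scoped commutatorElement

variable {G R n : Type*} [Group G] [CommRing R] [Fintype n] [DecidableEq n]

/-- The subgroup of those `g` with `f g` congruent to the identity matrix modulo `I`. -/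
def congruenceSubgroup (f : G →* GL n R) (I : Ideal R) : Subgroup G :=
  ((GeneralLinearGroup.map (Ideal.Quotient.mk I)).comp f).ker

instance (f : G →* GL n R) (I : Ideal R) : (congruenceSubgroup f I).Normal :=
  inferInstanceAs (MonoidHom.ker _).Normal

theorem mem_congruenceSubgroup {f : G →* GL n R} {I : Ideal R} {g : G} :
    g ∈ congruenceSubgroup f I ↔ ∀ i j, (f g).val i j - (1 : Matrix n n R) i j ∈ I := by
  rw [congruenceSubgroup, MonoidHom.mem_ker, Units.ext_iff, ← Matrix.ext_iff]
  refine forall₂_congr fun i j => ?_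
  rw [← Ideal.Quotient.eq]
  rw [Units.val_one, MonoidHom.comp_apply, GeneralLinearGroup.map_apply]
  rcases eq_or_ne i j with rfl | hij <;> simp [*]

/-- Rests on AB - BA = (A - 1)(B - 1) - (B - 1)(A - 1), whose entries lie in IJ. -/
theorem commutator_mem_congruenceSubgroup {f : G →* GL n R} {I J : Ideal R} {g h : G}
    (hg : g ∈ congruenceSubgroup f I) (hh : h ∈ congruenceSubgroup f J) :
    ⁅g, h⁆ ∈ congruenceSubgroup f (I * J) := by
  rw [mem_congruenceSubgroup] at hg hh
  rw [congruenceSubgroup, MonoidHom.mem_ker, map_commutatorElement, commutatorElement_eq_one_iff_mul_comm]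
  ext i j
  rw [← map_mul, ← map_mul, MonoidHom.comp_apply, MonoidHom.comp_apply,
    GeneralLinearGroup.map_apply, GeneralLinearGroup.map_apply, Ideal.Quotient.eq, map_mul, map_mul]
  have key : (f g).val * (f h).val - (f h).val * (f g).val =
      ((f g).val - 1) * ((f h).val - 1) - ((f h).val - 1) * ((f g).val - 1) := by noncomm_ring
  have key' := congrFun (congrFun key i) j
  simp only [Matrix.sub_apply (A := _ * _)] at key'
  rw [Units.val_mul, Units.val_mul, key']
  refine Ideal.sub_mem _ ?_ ?_
  · exact Ideal.sum_mem _ fun k _ => Ideal.mul_mem_mul (hg i k) (hh k j)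
  · refine Ideal.sum_mem _ fun k _ => ?_
    rw [mul_comm I J]
    exact Ideal.mul_mem_mul (hh i k) (hg k j)

theorem lowerCentralSeries_le_congruenceSubgroup {f : G →* GL n R} {I : Ideal R}
    (hI : congruenceSubgroup f I = ⊤) (k : ℕ) :
    (⊤ : Subgroup G).lowerCentralSeries k ≤ congruenceSubgroup f (I ^ (k + 1)) := by
  induction k with
  | zero => rw [zero_add, pow_one, hI]; exact le_top
  | succ k ih =>
    refine Subgroup.commutator_le.2 fun g hg h _ => ?_
    rw [pow_succ]
    exact commutator_mem_congruenceSubgroup (ih hg) (hI ▸ Subgroup.mem_top h)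

/-- A group of matrices over a noetherian domain that are all congruent to the identity modulo
a proper ideal is residually nilpotent. -/
theorem isResiduallyNilpotent_of_congruenceSubgroup_eq_top [IsDomain R] [IsNoetherianRing R]
    {f : G →* GL n R} (hf : Function.Injective f) {I : Ideal R} (hI : I ≠ ⊤)
    (h : congruenceSubgroup f I = ⊤) : IsResiduallyNilpotent G := by
  intro g hg
  obtain ⟨k, hk⟩ : ∃ k, g ∉ congruenceSubgroup f (I ^ (k + 1)) := by
    by_contra! hall
    apply hg
    apply hf
    rw [map_one]
    ext i j
    -- Krull's intersection theorem: an entry of f(g) - 1 lying in every power of I is zero.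
    rw [← sub_eq_zero, Units.val_one, ← Ideal.mem_bot, ← Ideal.iInf_pow_eq_bot_of_isDomain I hI,
      Ideal.mem_iInf]
    exact fun k => Ideal.pow_le_pow_right k.le_succ (mem_congruenceSubgroup.1 (hall k) i j)
  refine ⟨congruenceSubgroup f (I ^ (k + 1)), inferInstance, ?_, hk⟩
  rw [Subgroup.nilpotent_iff_lowerCentralSeries]
  refine ⟨k, ?_⟩
  rw [← Subgroup.map_top_of_surjective _ (QuotientGroup.mk'_surjective
    (congruenceSubgroup f (I ^ (k + 1)))), ← Subgroup.map_lowerCentralSeries, eq_bot_iff,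
    Subgroup.map_le_iff_le_comap, MonoidHom.comap_bot, QuotientGroup.ker_mk']
  exact lowerCentralSeries_le_congruenceSubgroup h k

end Congruence

end UniversalBraid

namespace UniversalBraid

/-! ### Faithfulness of the reduced Burau representation at -2 -/

section BraidPair

open Matrix

variable {G : Type*} [Group G] {a b : G}

/-- The elements `(a ^ 2) ^ k * (b ^ e * w * a ^ f)` with `w` a positive word in `a * b⁻¹` and
`a⁻¹ * b`. -/
def HasBraidForm (a b g : G) : Prop :=
  ∃ k : ℤ, ∃ e < 3, ∃ w ∈ Submonoid.closure {a * b⁻¹, a⁻¹ * b}, ∃ f < 2,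
    g = (a ^ 2) ^ k * (b ^ e * w * a ^ f)

theorem HasBraidForm.center_mul {g : G} (hg : HasBraidForm a b g) (n : ℤ) :
    HasBraidForm a b ((a ^ 2) ^ n * g) := by
  obtain ⟨k, e, he, w, hw, f, hf, rfl⟩ := hg
  exact ⟨n + k, e, he, w, hw, f, hf, by rw [_root_.zpow_add, mul_assoc ((a ^ 2) ^ n)]⟩

theorem HasBraidForm.mul_left_of_pow_three_eq (h : a ^ 2 = b ^ 3) {g : G}
    (hg : HasBraidForm a b g) : HasBraidForm a b (b * g) := by
  obtain ⟨k, e, he, w, hw, f, hf, rfl⟩ := hg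
  have hc : Commute b (a ^ 2) := h ▸ (Commute.refl b).pow_right 3
  rw [← mul_assoc, (hc.zpow_right k).eq, mul_assoc]
  refine HasBraidForm.center_mul ?_ k
  rw [← mul_assoc, ← mul_assoc, ← pow_succ']
  rcases Nat.lt_or_ge (e + 1) 3 with h3 | h3
  · exact ⟨0, e + 1, h3, w, hw, f, hf, by rw [zpow_zero, one_mul]⟩
  -- Here b · b² = a² is absorbed into the central factor.
  · obtain rfl : e = 2 := by omega
    exact ⟨1, 0, by norm_num, w, hw, f, hf, by
      rw [zpow_one, h, pow_zero, one_mul, mul_assoc]⟩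

/-- For e = 0 the first letter of w is consumed: a · ab⁻¹ = b² and a · a⁻¹b = b. For e = 1, 2 a
letter is created, up to the centre: ab = a² · a⁻¹b and ab² = a² · ab⁻¹. -/
theorem HasBraidForm.mul_left_of_sq_eq (h : a ^ 2 = b ^ 3) {g : G} (hg : HasBraidForm a b g) :
    HasBraidForm a b (a * g) := by
  obtain ⟨k, e, he, w, hw, f, hf, rfl⟩ := hg
  rw [← mul_assoc, (((Commute.refl a).pow_right 2).zpow_right k).eq, mul_assoc]
  refine HasBraidForm.center_mul ?_ k
  interval_cases e
  · rw [pow_zero, one_mul]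
    induction hw using Submonoid.closure_induction_left with
    | one =>
      rw [one_mul, ← pow_succ']
      interval_cases f
      · exact ⟨0, 0, by norm_num, 1, one_mem _, 1, by norm_num, by simp⟩
      · exact ⟨1, 0, by norm_num, 1, one_mem _, 0, by norm_num, by simp⟩
    | mul_left x hx w hw _ =>
      rcases hx with rfl | rfl
      · refine ⟨0, 2, by norm_num, w, hw, f, hf, ?_⟩
        have : a * (a * b⁻¹) = b ^ 2 := by
          rw [← mul_assoc, ← pow_two, h, pow_succ b 2, mul_inv_cancel_right]
        rw [zpow_zero, one_mul, ← this]
        simp only [mul_assoc]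
      · exact ⟨0, 1, by norm_num, w, hw, f, hf, by group⟩
  · refine ⟨1, 0, by norm_num, a⁻¹ * b * w,
      mul_mem (Submonoid.subset_closure (Or.inr rfl)) hw, f, hf, ?_⟩
    simp only [zpow_one, pow_zero, pow_one, one_mul, pow_two, mul_assoc, mul_inv_cancel_left]
  · refine ⟨1, 0, by norm_num, a * b⁻¹ * w,
      mul_mem (Submonoid.subset_closure (Or.inl rfl)) hw, f, hf, ?_⟩
    have : a * b ^ 2 = a ^ 2 * (a * b⁻¹) := by
      rw [← mul_assoc, ← pow_succ, pow_succ' a 2, h, pow_succ b 2, mul_assoc, mul_inv_cancel_right]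
    rw [zpow_one, pow_zero, one_mul, ← mul_assoc, ← mul_assoc, this]
    simp only [mul_assoc]

theorem hasBraidForm_of_mem_closure (h : a ^ 2 = b ^ 3) {g : G}
    (hg : g ∈ Subgroup.closure {a, b}) : HasBraidForm a b g := by
  induction hg using Subgroup.closure_induction_left with
  | one => exact ⟨0, 0, by norm_num, 1, one_mem _, 0, by norm_num, by simp⟩
  | mul_left x hx y _ ih =>
    rcases hx with rfl | rfl
    · exact ih.mul_left_of_sq_eq h
    · exact ih.mul_left_of_pow_three_eq h
  | inv_mul_cancel x hx y _ ih =>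
    rcases hx with rfl | rfl
    -- Up to the centre inverses are positive: a⁻¹ = a⁻² · a and b⁻¹ = a⁻² · b².
    · convert (ih.mul_left_of_sq_eq h).center_mul (-1) using 1
      group
    · convert ((ih.mul_left_of_pow_three_eq h).mul_left_of_pow_three_eq h).center_mul (-1) using 1
      rw [h]
      group

/-- Both letters are triangular with positive diagonal and one negative off-diagonal entry, and left
multiplication by either preserves this sign pattern, so no cancellation can occur. -/
theorem eq_one_or_sign_pattern (φ : G →* Matrix (Fin 2) (Fin 2) ℚ)
    (ha : φ a = !![0, -4; 2, 0]) (hb : φ b = !![2, -4; 1, 0]) {w : G}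
    (hw : w ∈ Submonoid.closure {a * b⁻¹, a⁻¹ * b}) :
    w = 1 ∨ (0 < φ w 0 0 ∧ 0 < φ w 1 1 ∧ φ w 0 1 ≤ 0 ∧ φ w 1 0 ≤ 0 ∧ φ w 0 1 + φ w 1 0 < 0) := by
  have ha' : φ a⁻¹ = !![0, 1 / 2; -1 / 4, 0] := by
    have h1 : φ a * !![0, 1 / 2; -1 / 4, 0] = 1 := by
      rw [ha, Matrix.mul_fin_two, Matrix.one_fin_two]
      norm_num
    exact left_inv_eq_right_inv (by rw [← map_mul, inv_mul_cancel, map_one]) h1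
  have hb' : φ b⁻¹ = !![0, 1; -1 / 4, 1 / 2] := by
    have h1 : φ b * !![0, 1; -1 / 4, 1 / 2] = 1 := by
      rw [hb, Matrix.mul_fin_two, Matrix.one_fin_two]
      norm_num
    exact left_inv_eq_right_inv (by rw [← map_mul, inv_mul_cancel, map_one]) h1
  have hx : φ (a * b⁻¹) = !![1, -2; 0, 2] := by
    rw [map_mul, ha, hb', Matrix.mul_fin_two]; norm_num
  have hy : φ (a⁻¹ * b) = !![1 / 2, 0; -1 / 2, 1] := by
    rw [map_mul, ha', hb, Matrix.mul_fin_two]; norm_num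
  induction hw using Submonoid.closure_induction_left with
  | one => exact Or.inl rfl
  | mul_left x hx' w hw ih =>
    right
    rcases hx' with rfl | rfl
    · rw [map_mul, hx]
      rcases ih with rfl | ⟨h1, h2, h3, h4, h5⟩
      · norm_num
      · rw [eta_fin_two (φ w), mul_fin_two]
        refine ⟨?_, ?_, ?_, ?_, ?_⟩ <;> simp <;> linarith
    · rw [map_mul, hy]
      rcases ih with rfl | ⟨h1, h2, h3, h4, h5⟩
      · norm_num
      · rw [eta_fin_two (φ w), mul_fin_two]
        refine ⟨?_, ?_, ?_, ?_, ?_⟩ <;> simp <;> linarith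

/-- The reduced Burau representation of the three-strand braid group `⟨a, b | a ^ 2 = b ^ 3⟩` is
faithful at the parameter `-2`. -/
theorem eq_one_of_reducedBurau_eq_one (h : a ^ 2 = b ^ 3) (φ : G →* Matrix (Fin 2) (Fin 2) ℚ)
    (ha : φ a = !![0, -4; 2, 0]) (hb : φ b = !![2, -4; 1, 0]) {g : G}
    (hg : g ∈ Subgroup.closure {a, b}) (h1 : φ g = 1) : g = 1 := by
  obtain ⟨k, e, he, w, hw, f, hf, rfl⟩ := hasBraidForm_of_mem_closure h hg
  have hc : φ.toHomUnits (a ^ 2) =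
      Units.map (Matrix.scalar (Fin 2)).toMonoidHom (Units.mk0 (-8 : ℚ) (by norm_num)) := by
    ext i j
    change φ (a ^ 2) i j = Matrix.scalar (Fin 2) (-8 : ℚ) i j
    rw [map_pow, ha, pow_two, Matrix.mul_fin_two]
    fin_cases i <;> fin_cases j <;> norm_num [Matrix.scalar_apply]
  have hck : φ ((a ^ 2) ^ k) = ((-8 : ℚ) ^ k) • 1 := by
    change (φ.toHomUnits ((a ^ 2) ^ k)).val = _
    rw [map_zpow, hc, ← map_zpow, Units.coe_map, Matrix.smul_one_eq_diagonal]
    simp [Matrix.scalar_apply]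
  have hk0 : (-8 : ℚ) ^ k ≠ 0 := zpow_ne_zero _ (by norm_num)
  rw [map_mul, hck, smul_mul_assoc, one_mul] at h1
  have h01 := congrFun (congrFun h1 0) 1
  have h10 := congrFun (congrFun h1 1) 0
  have h00 := congrFun (congrFun h1 0) 0
  -- Since a² acts as the scalar -8, φ(g) = 1 forces the off-diagonal entries of φ(b^e w a^f) to
  -- vanish. The sign pattern excludes this for all six (e, f) unless w = 1, and then only e = f = 0
  -- survives.
  rw [Matrix.smul_apply, smul_eq_mul, one_apply_ne (by decide), mul_eq_zero_iff_left hk0,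
    map_mul, map_mul, map_pow, map_pow, ha, hb] at h01 h10
  rcases eq_one_or_sign_pattern φ ha hb hw with rfl | ⟨w1, w2, w3, w4, w5⟩
  · rw [map_one] at h01 h10
    interval_cases e <;> interval_cases f <;>
      first | (norm_num [pow_succ] at h01; done) | (norm_num [pow_succ] at h10; done) | skip
    rw [pow_zero, pow_zero, mul_one, mul_one, map_one, Matrix.smul_apply, one_apply_eq,
      smul_eq_mul, mul_one] at h00
    have hk : k = 0 := by
      have := congrArg abs h00
      rw [abs_zpow] at this
      norm_num at this
      exact (zpow_eq_one_iff_right₀ (by norm_num) (by norm_num)).1 this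
    simp [hk]
  · exfalso
    rw [eta_fin_two (φ w)] at h01 h10
    interval_cases e <;> interval_cases f <;>
      simp only [pow_zero, pow_one, pow_two, mul_one, one_mul, mul_fin_two, of_apply, cons_val',
        cons_val_zero, cons_val_one, cons_val_fin_one] at h01 h10 <;> linarith

end BraidPair

end UniversalBraid

namespace UniversalBraid

open Matrix

/-! ### Generators of `UB 3` and its braid subgroup -/

section Generators

/-- The generator `σ_i` of `UB 3`. -/
def sig (i : Fin 2) : UB 3 := PresentedGroup.of (Gen.sigma i)

/-- The generator `τ_i` of `UB 3`. -/
def tau (i : Fin 2) : UB 3 := PresentedGroup.of (Gen.tau i)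

theorem not_far_three (i j : Fin (3 - 1)) : ¬ Far i j := by
  have := i.isLt
  have := j.isLt
  unfold Far
  omega

theorem sig_braid : sig 0 * sig 1 * sig 0 = sig 1 * sig 0 * sig 1 :=
  PresentedGroup.mk_eq_mk_of_mul_inv_mem (IsRelator.braid (n := 3) 0 1 rfl)

theorem mem_of_generators_mem (H : Subgroup (UB 3)) (hs : ∀ i, sig i ∈ H) (ht : ∀ i, tau i ∈ H)
    (g : UB 3) : g ∈ H := by
  refine PresentedGroup.generated_by _ H ?_ g
  rintro (i | i)
  · exact hs i
  · exact ht i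

/-- The homomorphism on `UB 3` with prescribed values on the generators. -/
def liftThree {H : Type*} [Group H] (A C : Fin 2 → H)
    (h : A 0 * A 1 * A 0 = A 1 * A 0 * A 1) : UB 3 →* H :=
  PresentedGroup.toGroup (f := fun x : Gen 3 => match x with | .sigma i => A i | .tau i => C i) <| by
    rintro _ (⟨i, j, hij⟩ | ⟨i, j, hij⟩ | ⟨i, j, hij⟩ | ⟨i, j, hij⟩)
    · obtain rfl : i = (0 : Fin 2) := by ext; have := i.isLt; have := j.isLt; simp; omega
      obtain rfl : j = (1 : Fin 2) := by ext; simpa using hij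
      rw [map_mul, map_inv, mul_inv_eq_one]
      simpa only [s, map_mul, FreeGroup.lift_apply_of] using h
    all_goals exact absurd hij (not_far_three i j)

variable {H : Type*} [Group H] (A C : Fin 2 → H) (h : A 0 * A 1 * A 0 = A 1 * A 0 * A 1)

@[simp]
theorem liftThree_sig (i : Fin 2) : liftThree A C h (sig i) = A i := PresentedGroup.toGroup.of _

@[simp]
theorem liftThree_tau (i : Fin 2) : liftThree A C h (tau i) = C i := PresentedGroup.toGroup.of _

theorem hom_ext_three {f g : UB 3 →* H} (hs : ∀ i, f (sig i) = g (sig i))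
    (ht : ∀ i, f (tau i) = g (tau i)) : f = g := by
  refine PresentedGroup.ext ?_
  rintro (i | i)
  · exact hs i
  · exact ht i

/-- The subgroup generated by the `σ_i`, a copy of the braid group on three strands. -/
def braidSubgroup : Subgroup (UB 3) := Subgroup.closure (Set.range sig)

/-- The free generators complementing `braidSubgroup`. -/
def freeGen (i : Fin 2) : UB 3 := (sig i)⁻¹ * tau i

theorem sig_mem_braidSubgroup (i : Fin 2) : sig i ∈ braidSubgroup :=
  Subgroup.subset_closure ⟨i, rfl⟩

theorem closure_braidSubgroup_freeGen :
    Subgroup.closure ((braidSubgroup : Set (UB 3)) ∪ Set.range freeGen) = ⊤ := by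
  have hs : ∀ i, sig i ∈ Subgroup.closure ((braidSubgroup : Set (UB 3)) ∪ Set.range freeGen) :=
    fun i => Subgroup.subset_closure (Or.inl (sig_mem_braidSubgroup i))
  refine (Subgroup.eq_top_iff' _).2 (mem_of_generators_mem _ hs fun i => ?_)
  have : freeGen i ∈ Subgroup.closure ((braidSubgroup : Set (UB 3)) ∪ Set.range freeGen) :=
    Subgroup.subset_closure (Or.inr ⟨i, rfl⟩)
  simpa [freeGen] using Subgroup.mul_mem _ (hs i) this

theorem mem_closure_of_mem_braidSubgroup {g : UB 3} (hg : g ∈ braidSubgroup) :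
    g ∈ Subgroup.closure {sig 0 * sig 1 * sig 0, sig 0 * sig 1} := by
  have ha : sig 0 * sig 1 * sig 0 ∈ Subgroup.closure {sig 0 * sig 1 * sig 0, sig 0 * sig 1} :=
    Subgroup.subset_closure (Or.inl rfl)
  have hb : sig 0 * sig 1 ∈ Subgroup.closure {sig 0 * sig 1 * sig 0, sig 0 * sig 1} :=
    Subgroup.subset_closure (Or.inr rfl)
  have h0 : sig 0 ∈ Subgroup.closure {sig 0 * sig 1 * sig 0, sig 0 * sig 1} := by
    have := Subgroup.mul_mem _ (Subgroup.inv_mem _ hb) ha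
    rwa [inv_mul_cancel_left] at this
  have h1 : sig 1 ∈ Subgroup.closure {sig 0 * sig 1 * sig 0, sig 0 * sig 1} := by
    have := Subgroup.mul_mem _ (Subgroup.inv_mem _ h0) hb
    rwa [inv_mul_cancel_left] at this
  refine (Subgroup.closure_le _).2 ?_ hg
  rintro _ ⟨i, rfl⟩
  fin_cases i
  · exact h0
  · exact h1

theorem garside_sq_eq : (sig 0 * sig 1 * sig 0) ^ 2 = (sig 0 * sig 1) ^ 3 := by
  rw [pow_two]
  nth_rw 2 [sig_braid]
  simp only [pow_succ, pow_zero, one_mul, mul_assoc]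

end Generators

/-! ### The unreduced Burau representation, extended to `UB 3` -/

section Burau

variable {R S : Type*} [CommRing R] [CommRing S]

/-- The unreduced Burau matrices on three strands. -/
def burauGen (t : Rˣ) : Fin 2 → GL (Fin 3) R :=
  ![⟨!![1 - t, t, 0; 1, 0, 0; 0, 0, 1], !![0, 1, 0; (t⁻¹ : Rˣ), 1 - (t⁻¹ : Rˣ), 0; 0, 0, 1],
      by simp [← Matrix.ext_iff, Fin.forall_fin_succ, mul_sub],
      by simp [← Matrix.ext_iff, Fin.forall_fin_succ, mul_sub]⟩,
    ⟨!![1, 0, 0; 0, 1 - t, t; 0, 1, 0], !![1, 0, 0; 0, 0, 1; 0, (t⁻¹ : Rˣ), 1 - (t⁻¹ : Rˣ)],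
      by simp [← Matrix.ext_iff, Fin.forall_fin_succ, mul_sub],
      by simp [← Matrix.ext_iff, Fin.forall_fin_succ, mul_sub]⟩]

theorem burauGen_zero (t : Rˣ) :
    (burauGen t 0).val = !![1 - (t : R), t, 0; 1, 0, 0; 0, 0, 1] := rfl

theorem burauGen_one (t : Rˣ) :
    (burauGen t 1).val = !![1, 0, 0; 0, 1 - (t : R), t; 0, 1, 0] := rfl

theorem burauGen_braid (t : Rˣ) : burauGen t 0 * burauGen t 1 * burauGen t 0 =
    burauGen t 1 * burauGen t 0 * burauGen t 1 := by
  apply Units.ext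
  rw [Units.val_mul, Units.val_mul, Units.val_mul, Units.val_mul, burauGen_zero, burauGen_one]
  ext i j
  fin_cases i <;> fin_cases j <;> simp [Matrix.mul_apply, Fin.sum_univ_succ] <;> ring

theorem map_burauGen (f : R →+* S) (t : Rˣ) (i : Fin 2) :
    GeneralLinearGroup.map f (burauGen t i) = burauGen (Units.map f.toMonoidHom t) i := by
  ext a b
  fin_cases i <;> rw [GeneralLinearGroup.map_apply] <;>
    fin_cases a <;> fin_cases b <;> simp [burauGen]

/-- The Burau representation on the `σ_i`, extended to `UB 3` by `τ_i ↦ σ_i * U i`. -/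
def burauRep (t : Rˣ) (U : Fin 2 → GL (Fin 3) R) : UB 3 →* GL (Fin 3) R :=
  liftThree (burauGen t) (fun i => burauGen t i * U i) (burauGen_braid t)

theorem burauRep_sig (t : Rˣ) (U : Fin 2 → GL (Fin 3) R) (i : Fin 2) :
    burauRep t U (sig i) = burauGen t i := liftThree_sig _ _ _ i

theorem burauRep_tau (t : Rˣ) (U : Fin 2 → GL (Fin 3) R) (i : Fin 2) :
    burauRep t U (tau i) = burauGen t i * U i := liftThree_tau _ _ _ i

theorem burauRep_freeGen (t : Rˣ) (U : Fin 2 → GL (Fin 3) R) (i : Fin 2) :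
    burauRep t U (freeGen i) = U i := by
  rw [freeGen, map_mul, map_inv, burauRep_sig, burauRep_tau, inv_mul_cancel_left]

theorem map_burauRep (f : R →+* S) (t : Rˣ) (U : Fin 2 → GL (Fin 3) R) (g : UB 3) :
    GeneralLinearGroup.map f (burauRep t U g) =
      burauRep (Units.map f.toMonoidHom t) (fun i => GeneralLinearGroup.map f (U i)) g := by
  rw [← MonoidHom.comp_apply]
  refine DFunLike.congr_fun (hom_ext_three ?_ ?_) g <;> intro i
  · rw [MonoidHom.comp_apply, burauRep_sig, burauRep_sig, map_burauGen]
  · rw [MonoidHom.comp_apply, burauRep_tau, burauRep_tau, map_mul, map_burauGen]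

theorem map_burauRep_one (f : R →+* S) (t : Rˣ) (g : UB 3) :
    GeneralLinearGroup.map f (burauRep t 1 g) = burauRep (Units.map f.toMonoidHom t) 1 g := by
  rw [map_burauRep]
  congr
  ext1 i
  exact map_one _

theorem burauRep_eq_of_mem_braidSubgroup (t : Rˣ) (U V : Fin 2 → GL (Fin 3) R) {g : UB 3}
    (hg : g ∈ braidSubgroup) : burauRep t U g = burauRep t V g := by
  refine MonoidHom.eqOn_closure (f := burauRep t U) (g := burauRep t V) ?_ hg
  rintro _ ⟨i, rfl⟩
  rw [burauRep_sig, burauRep_sig]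

theorem intertwine {m n : Type*} [Fintype m] [DecidableEq m] [Fintype n] [DecidableEq n]
    (f : UB 3 →* GL m R) (f' : UB 3 →* GL n R) (Q : Matrix m n R)
    (hs : ∀ i, (f (sig i)).val * Q = Q * (f' (sig i)).val)
    (ht : ∀ i, (f (tau i)).val * Q = Q * (f' (tau i)).val) (g : UB 3) :
    (f g).val * Q = Q * (f' g).val := by
  let H : Subgroup (UB 3) :=
    { carrier := {g | (f g).val * Q = Q * (f' g).val}
      one_mem' := by simp
      mul_mem' := fun {a b} (ha : _ = _) (hb : _ = _) => by
        change _ = _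
        rw [map_mul, map_mul, Units.val_mul, Units.val_mul, Matrix.mul_assoc, hb,
          ← Matrix.mul_assoc, ha, Matrix.mul_assoc]
      inv_mem' := fun {a} (ha : _ = _) => by
        change _ = _
        have h1 : (f a⁻¹).val * (f a).val = 1 := by rw [← Units.val_mul, ← map_mul]; simp
        have h2 : (f' a).val * (f' a⁻¹).val = 1 := by rw [← Units.val_mul, ← map_mul]; simp
        calc (f a⁻¹).val * Q = (f a⁻¹).val * (Q * (f' a).val) * (f' a⁻¹).val := by
              rw [Matrix.mul_assoc, Matrix.mul_assoc, h2, Matrix.mul_one]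
          _ = Q * (f' a⁻¹).val := by rw [← ha, ← Matrix.mul_assoc, h1, Matrix.one_mul] }
  exact mem_of_generators_mem H hs ht g

/-- The all-ones column is fixed by every Burau matrix. This later pins a scalar Burau matrix down
to the identity. -/
theorem sum_row_burauRep_one (t : Rˣ) (g : UB 3) (i : Fin 3) :
    ∑ j, (burauRep t 1 g).val i j = 1 := by
  have hs : ∀ i, (burauGen t i).val * (of fun _ _ => 1 : Matrix (Fin 3) Unit R) =
      (of fun _ _ => 1 : Matrix (Fin 3) Unit R) * (1 : Matrix Unit Unit R) := by
    intro i
    ext a b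
    fin_cases i <;> fin_cases a <;> simp [burauGen, Fin.sum_univ_succ, Matrix.mul_apply]
  have := intertwine (burauRep t 1) 1 (of fun _ (_ : Unit) => (1 : R))
    (fun i => by rw [burauRep_sig]; exact hs i)
    (fun i => by rw [burauRep_tau, Pi.one_apply, mul_one]; exact hs i) g
  simpa [Matrix.mul_apply] using congrFun (congrFun this i) ()

theorem burauRep_one_one (g : UB 3) :
    (burauRep (1 : Rˣ) 1 g).val = permMatrixHom (toPerm 3 g) := by
  have hs : ∀ i, burauGen (1 : Rˣ) i =
      (permMatrixHom (n := Fin 3) (R := R)).toHomUnits (adjSwap (n := 3) i) := by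
    intro i
    ext a b
    fin_cases i <;> fin_cases a <;> fin_cases b <;>
      simp [burauGen, adjSwap, PEquiv.toMatrix_apply, Equiv.swap_apply_def]
  have : burauRep (1 : Rˣ) 1 = (permMatrixHom (R := R)).toHomUnits.comp (toPerm 3) := by
    refine hom_ext_three (fun i => ?_) (fun i => ?_)
    · rw [burauRep_sig, hs]
      rfl
    · rw [burauRep_tau, Pi.one_apply, mul_one, hs]
      rfl
  rw [this]
  rfl

end Burau

/-! ### From reduced to unreduced Burau -/

section Faithful

/-- The reduced Burau matrices on three strands at the parameter `-2`. -/
def reducedGen : Fin 2 → GL (Fin 2) ℚ :=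
  ![⟨!![2, 0; 1, 1], !![1 / 2, 0; -1 / 2, 1],
      by rw [mul_fin_two, one_fin_two]; norm_num, by rw [mul_fin_two, one_fin_two]; norm_num⟩,
    ⟨!![1, -2; 0, 2], !![1, 1; 0, 1 / 2],
      by rw [mul_fin_two, one_fin_two]; norm_num, by rw [mul_fin_two, one_fin_two]; norm_num⟩]

theorem reducedGen_braid : reducedGen 0 * reducedGen 1 * reducedGen 0 =
    reducedGen 1 * reducedGen 0 * reducedGen 1 := by
  apply Units.ext
  simp only [reducedGen, Units.val_mul, cons_val_zero, cons_val_one, mul_fin_two]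
  norm_num

/-- The reduced Burau representation at the parameter `-2`, with `τ_i ↦ σ_i`. -/
def reducedRep : UB 3 →* GL (Fin 2) ℚ := liftThree reducedGen reducedGen reducedGen_braid

theorem reducedRep_injective_on {g : UB 3} (hg : g ∈ braidSubgroup) (h : reducedRep g = 1) :
    g = 1 := by
  refine eq_one_of_reducedBurau_eq_one garside_sq_eq
    ((Units.coeHom _).comp reducedRep) ?_ ?_ (mem_closure_of_mem_braidSubgroup hg)
    (congrArg Units.val h)
  · simp only [reducedRep, MonoidHom.comp_apply, map_mul, liftThree_sig]
    simp [reducedGen]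
    norm_num
  · simp only [reducedRep, MonoidHom.comp_apply, map_mul, liftThree_sig]
    simp [reducedGen]
    norm_num

/-- The row vectors with coordinate sum zero are invariant under right multiplication; in the basis
of successive differences the action is the reduced one. That basis matrix has a right inverse, so
unreduced triviality implies reduced triviality. -/
theorem reducedRep_mul (t : ℚˣ) (ht : (t : ℚ) = -2) (g : UB 3) :
    (reducedRep g).val * (!![1, -1, 0; 0, 1, -1] : Matrix (Fin 2) (Fin 3) ℚ) =
      (!![1, -1, 0; 0, 1, -1] : Matrix (Fin 2) (Fin 3) ℚ) * (burauRep t 1 g).val := by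
  have hs : ∀ i, (reducedGen i).val * (!![1, -1, 0; 0, 1, -1] : Matrix (Fin 2) (Fin 3) ℚ) =
      (!![1, -1, 0; 0, 1, -1] : Matrix (Fin 2) (Fin 3) ℚ) * (burauGen t i).val := by
    intro i
    ext a b
    fin_cases i <;> fin_cases a <;> fin_cases b <;>
      norm_num [reducedGen, burauGen, ht, Matrix.mul_apply, Fin.sum_univ_succ]
  refine intertwine _ _ _ (fun i => ?_) (fun i => ?_) g
  · rw [burauRep_sig, reducedRep, liftThree_sig, hs]
  · rw [burauRep_tau, Pi.one_apply, mul_one, reducedRep, liftThree_tau, hs]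

theorem eq_one_of_burauRep_eq_one (t : ℚˣ) (ht : (t : ℚ) = -2) {g : UB 3}
    (hg : g ∈ braidSubgroup) (h : burauRep t 1 g = 1) : g = 1 := by
  refine reducedRep_injective_on hg (Units.ext ?_)
  have key := congrArg (· * (!![1, 1; 0, 1; 0, 0] : Matrix (Fin 3) (Fin 2) ℚ))
    (reducedRep_mul t ht g)
  have hQ : (!![1, -1, 0; 0, 1, -1] : Matrix (Fin 2) (Fin 3) ℚ) *
      (!![1, 1; 0, 1; 0, 0] : Matrix (Fin 3) (Fin 2) ℚ) = 1 := by
    ext i j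
    fin_cases i <;> fin_cases j <;> simp
  simpa only [h, Units.val_one, Matrix.mul_one, Matrix.mul_assoc, hQ] using key

end Faithful

end UniversalBraid

namespace UniversalBraid

open Matrix Polynomial

/-! ### Leading coefficients and rank-one transvections -/

section RankOne

variable {R n : Type*} [CommRing R]

/-- The entries of `A` have degree at most `k`, and their coefficients of degree `k` form `α`. -/
def HasLeadingMatrix (A : Matrix n n R[X]) (k : ℕ) (α : Matrix n n R) : Prop :=
  ∀ i j, (A i j).natDegree ≤ k ∧ (A i j).coeff k = α i j

theorem hasLeadingMatrix_map_C (α : Matrix n n R) : HasLeadingMatrix (α.map C) 0 α :=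
  fun i j => by simp

variable [Fintype n]

theorem HasLeadingMatrix.map_C_mul {A : Matrix n n R[X]} {k : ℕ} {α : Matrix n n R}
    (h : HasLeadingMatrix A k α) (β : Matrix n n R) : HasLeadingMatrix (β.map C * A) k (β * α) := by
  intro i j
  rw [Matrix.mul_apply, Matrix.mul_apply]
  refine ⟨natDegree_sum_le_of_forall_le _ _ fun c _ => ?_, ?_⟩
  · exact (natDegree_C_mul_le _ _).trans (h c j).1
  · simp [finsetSum_coeff, (h _ j).2]

variable [DecidableEq n]

theorem HasLeadingMatrix.one_add_X_smul_mul {A : Matrix n n R[X]} {k : ℕ} {α : Matrix n n R}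
    (h : HasLeadingMatrix A k α) (β : Matrix n n R) :
    HasLeadingMatrix ((1 + (X : R[X]) • β.map C) * A) (k + 1) (β * α) := by
  intro i j
  rw [add_mul, one_mul, smul_mul_assoc, Matrix.add_apply, Matrix.smul_apply, smul_eq_mul]
  have h' := h.map_C_mul β i j
  refine ⟨(natDegree_add_le _ _).trans (max_le ((h i j).1.trans k.le_succ) ?_), ?_⟩
  · exact natDegree_mul_le.trans (by have := natDegree_X_le (R := R); omega)
  · rw [coeff_add, coeff_X_mul, h'.2, coeff_eq_zero_of_natDegree_lt (by have := (h i j).1; omega),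
      zero_add]

theorem units_zpow_val_of_sq_zero {U : GL n R} {M : Matrix n n R} (hM : M * M = 0)
    (h : U.val = 1 + M) (m : ℤ) : (U ^ m).val = 1 + (m : R) • M := by
  have hinv : (U⁻¹).val = 1 - M := by
    refine left_inv_eq_right_inv (show (U⁻¹).val * U.val = 1 from U.inv_mul) ?_
    rw [h, add_mul, mul_sub, mul_sub, hM]
    simp
  induction m with
  | zero => simp
  | succ k ih =>
    rw [_root_.zpow_add_one, Units.val_mul, ih, h, add_mul, mul_add, mul_add, smul_mul_assoc _ M M, hM]
    push_cast
    simp only [smul_zero, add_smul, one_smul, mul_one, one_mul]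
    abel
  | pred k ih =>
    rw [_root_.zpow_sub_one, Units.val_mul, ih, hinv, add_mul, mul_sub, mul_sub,
      smul_mul_assoc _ M M, hM]
    push_cast
    simp only [smul_zero, sub_smul, one_smul, mul_one, one_mul]
    abel

theorem X_smul_vecMulVec_mul_self {u v : n → R} (h : v ⬝ᵥ u = 0) :
    ((X : R[X]) • (vecMulVec u v).map C) * ((X : R[X]) • (vecMulVec u v).map C) = 0 := by
  rw [smul_mul_assoc, mul_smul_comm, ← Matrix.map_mul, vecMulVec_mul_vecMulVec, h]
  simp

/-- The unipotent matrix `1 + y u vᵀ` over the polynomials in `y`. -/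
noncomputable def rankOneUnit (u v : n → R) (h : v ⬝ᵥ u = 0) : GL n R[X] where
  val := 1 + (X : R[X]) • (vecMulVec u v).map C
  inv := 1 - (X : R[X]) • (vecMulVec u v).map C
  val_inv := by
    rw [add_mul, mul_sub, mul_sub, X_smul_vecMulVec_mul_self h, mul_one, mul_one, one_mul]
    abel
  inv_val := by
    rw [sub_mul, mul_add, mul_add, X_smul_vecMulVec_mul_self h, mul_one, mul_one, one_mul]
    abel

theorem rankOneUnit_zpow (u v : n → R) (h : v ⬝ᵥ u = 0) (m : ℤ) :
    (rankOneUnit u v h ^ m).val = 1 + (X : R[X]) • ((m : R) • vecMulVec u v).map C := by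
  rw [units_zpow_val_of_sq_zero (X_smul_vecMulVec_mul_self h) rfl]
  ext1 i j
  simp
  ring

end RankOne

/-! ### Injectivity by degree in y -/

section Injectivity

variable {P : Type*} [CommRing P]

/-- The Burau representation extended by `τ_i ↦ σ_i (1 + y u_i v_iᵀ)`. -/
noncomputable def extendedBurau (t : Pˣ) (u v : Fin 2 → Fin 3 → P) (huv : ∀ i, v i ⬝ᵥ u i = 0) :
    UB 3 →* GL (Fin 3) P[X] :=
  burauRep (Units.map (C : P →+* P[X]).toMonoidHom t) fun i => rankOneUnit (u i) (v i) (huv i)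

variable {t : Pˣ} {u v : Fin 2 → Fin 3 → P} {huv : ∀ i, v i ⬝ᵥ u i = 0}

theorem extendedBurau_of_mem_braidSubgroup {g : UB 3} (hg : g ∈ braidSubgroup) :
    (extendedBurau t u v huv g).val = (burauRep t 1 g).val.map C := by
  rw [extendedBurau, burauRep_eq_of_mem_braidSubgroup _ _ 1 hg, ← map_burauRep_one]
  rfl

variable [IsDomain P] [CharZero P]

/-- Each syllable x_i^m = 1 + m y u_i v_iᵀ raises the degree by one. The top coefficient stays of
rank one because (u_i v_iᵀ) ρ(g) (u_j rᵀ) = (v_iᵀρ(g)u_j) u_i rᵀ, and the pairing is nonzero by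
`hpair`. -/
theorem exists_hasLeadingMatrix (hv : ∀ i, v i ≠ 0)
    (hpair : ∀ i j, ∀ g ∈ braidSubgroup, (i = j → g ≠ 1) →
      v i ⬝ᵥ (burauRep t 1 g).val *ᵥ u j ≠ 0)
    {i : Fin 2} {w : UB 3} (hw : ReducedFrom braidSubgroup freeGen i w) :
    ∃ (k : ℕ) (r : Fin 3 → P), r ≠ 0 ∧
      HasLeadingMatrix (extendedBurau t u v huv w).val (k + 1) (vecMulVec (u i) r) := by
  have hx : ∀ i (m : ℤ), (extendedBurau t u v huv (freeGen i ^ m)).val =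
      1 + (X : P[X]) • ((m : P) • vecMulVec (u i) (v i)).map C := by
    intro i m
    rw [map_zpow, extendedBurau, burauRep_freeGen, rankOneUnit_zpow]
  induction hw with
  | single i m g hm hg =>
    refine ⟨0, (m : P) • (v i ᵥ* (burauRep t 1 g).val), ?_, ?_⟩
    · refine smul_ne_zero (by exact_mod_cast hm) fun h0 => hv i ?_
      have := congrArg (· ᵥ* (burauRep t 1 g)⁻¹.val) h0
      simpa only [vecMul_vecMul, zero_vecMul, Units.mul_inv, vecMul_one] using this
    · have := (hasLeadingMatrix_map_C (burauRep t 1 g).val).one_add_X_smul_mul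
        ((m : P) • vecMulVec (u i) (v i))
      rw [map_mul, Units.val_mul, hx, extendedBurau_of_mem_braidSubgroup hg]
      rw [vecMulVec_smul, ← vecMulVec_mul, ← smul_mul_assoc]
      exact this
  | cons i j m g w hm hg hij hw ih =>
    obtain ⟨k, r, hr, hl⟩ := ih
    refine ⟨k + 1, ((m : P) * (v i ⬝ᵥ (burauRep t 1 g).val *ᵥ u j)) • r, ?_, ?_⟩
    · exact smul_ne_zero (mul_ne_zero (by exact_mod_cast hm) (hpair i j g hg hij)) hr
    · have := (hl.map_C_mul (burauRep t 1 g).val).one_add_X_smul_mul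
        ((m : P) • vecMulVec (u i) (v i))
      rw [map_mul, map_mul, Units.val_mul, Units.val_mul, hx,
        extendedBurau_of_mem_braidSubgroup hg]
      rw [mul_smul, vecMulVec_smul, ← vecMulVec_mul_vecMulVec, ← smul_mul_assoc, ← mul_vecMulVec]
      exact this

theorem extendedBurau_injective (hu : ∀ i, u i ≠ 0) (hv : ∀ i, v i ≠ 0)
    (hfaith : ∀ g ∈ braidSubgroup, burauRep t 1 g = 1 → g = 1)
    (hpair : ∀ i j, ∀ g ∈ braidSubgroup, (i = j → g ≠ 1) →
      v i ⬝ᵥ (burauRep t 1 g).val *ᵥ u j ≠ 0) :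
    Function.Injective (extendedBurau t u v huv) := by
  rw [injective_iff_map_eq_one]
  intro w hw
  rcases hasReducedForm_of_closure_eq_top closure_braidSubgroup_freeGen w with
    h | ⟨g, hg, i, w', hw', rfl⟩
  · refine hfaith w h (Units.ext ?_)
    have := extendedBurau_of_mem_braidSubgroup (t := t) (u := u) (v := v) (huv := huv) h
    rw [hw] at this
    refine Matrix.map_injective (C_injective (R := P)) ?_
    exact this.symm.trans (by simp)
  · exfalso
    obtain ⟨k, r, hr, hl⟩ := exists_hasLeadingMatrix (huv := huv) hv hpair hw'
    -- The image of g⁻¹ is constant in y, while that of w' has a nonzero coefficient in degree k + 1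
    -- > 0.
    have h1 : extendedBurau t u v huv w' = extendedBurau t u v huv g⁻¹ := by
      rw [map_inv, ← mul_eq_one_iff_eq_inv', ← map_mul, hw]
    obtain ⟨a, ha⟩ := Function.ne_iff.1 (hu i)
    obtain ⟨b, hb⟩ := Function.ne_iff.1 hr
    have h2 := (hl a b).2
    rw [h1, extendedBurau_of_mem_braidSubgroup (braidSubgroup.inv_mem hg), Matrix.map_apply,
      coeff_C_of_ne_zero k.succ_ne_zero, vecMulVec_apply] at h2
    exact mul_ne_zero ha hb h2.symm

end Injectivity

end UniversalBraid

namespace UniversalBraid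

open Matrix Polynomial

/-! ### Vectors with sparse exponents -/

section Generic

/-- The vectors `u_i`, with sparse exponents of the variable `z`. -/
noncomputable def genericU (R : Type*) [CommRing R] (i : Fin 2) : Fin 3 → R[X] :=
  let e : ℕ := ![1, 10] i
  ![-(X ^ (4 * e) + X ^ (7 * e)), X ^ (3 * e), 1]

/-- The vectors `v_i`, orthogonal to the `u_i`. -/
noncomputable def genericV (R : Type*) [CommRing R] (i : Fin 2) : Fin 3 → R[X] :=
  let e : ℕ := ![1, 10] i
  ![1, X ^ e, X ^ (7 * e)]

variable {R : Type*} [CommRing R]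

theorem genericV_dotProduct_genericU (i : Fin 2) : genericV R i ⬝ᵥ genericU R i = 0 := by
  fin_cases i <;> simp [genericU, genericV, dotProduct, Fin.sum_univ_succ] <;> ring

theorem genericU_ne_zero [Nontrivial R] (i : Fin 2) : genericU R i ≠ 0 :=
  fun h => one_ne_zero (congrFun h 2)

theorem genericV_ne_zero [Nontrivial R] (i : Fin 2) : genericV R i ≠ 0 :=
  fun h => one_ne_zero (congrFun h 0)

theorem generic_pairing (A : Matrix (Fin 3) (Fin 3) R) (i j : Fin 2) :
    genericV R i ⬝ᵥ A.map C *ᵥ genericU R j =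
      let d : ℕ := ![1, 10] i
      let e : ℕ := ![1, 10] j
      (C (A 0 2) * X ^ 0 + C (A 0 1) * X ^ (3 * e) + C (-A 0 0) * X ^ (4 * e)
        + C (-A 0 0) * X ^ (7 * e))
      + (C (A 1 2) * X ^ d + C (A 1 1) * X ^ (d + 3 * e) + C (-A 1 0) * X ^ (d + 4 * e)
        + C (-A 1 0) * X ^ (d + 7 * e))
      + (C (A 2 2) * X ^ (7 * d) + C (A 2 1) * X ^ (7 * d + 3 * e)
        + C (-A 2 0) * X ^ (7 * d + 4 * e) + C (-A 2 0) * X ^ (7 * d + 7 * e)) := by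
  simp only [genericU, genericV, dotProduct, mulVec, Fin.sum_univ_three, map_apply, cons_val_zero,
    cons_val_one, cons_val, map_neg]
  ring

/-- The scale factor 10 exceeds 7, so sums of an exponent of v_i and one of u_j never collide: each
entry of A is, up to sign, a coefficient of the pairing. -/
theorem eq_zero_of_generic_pairing_eq_zero {A : Matrix (Fin 3) (Fin 3) R} {i j : Fin 2}
    (hij : i ≠ j) (h : genericV R i ⬝ᵥ A.map C *ᵥ genericU R j = 0) : A = 0 := by
  rw [generic_pairing] at h
  have hc := fun n => congrArg (fun p => coeff p n) h
  simp only [coeff_add, coeff_C_mul_X_pow, coeff_zero] at hc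
  have key : i = 0 ∧ j = 1 ∨ i = 1 ∧ j = 0 := by omega
  ext a b
  rcases key with ⟨rfl, rfl⟩ | ⟨rfl, rfl⟩
  · have h0 := hc 0
    have h1 := hc 1
    have h2 := hc 7
    have h3 := hc 30
    have h4 := hc 31
    have h5 := hc 37
    have h6 := hc 70
    have h7 := hc 71
    have h8 := hc 77
    norm_num at h0 h1 h2 h3 h4 h5 h6 h7 h8
    fin_cases a <;> fin_cases b <;> assumption
  · have h0 := hc 0
    have h1 := hc 10
    have h2 := hc 70
    have h3 := hc 3
    have h4 := hc 13
    have h5 := hc 73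
    have h6 := hc 7
    have h7 := hc 17
    have h8 := hc 77
    norm_num at h0 h1 h2 h3 h4 h5 h6 h7 h8
    fin_cases a <;> fin_cases b <;> assumption

/-- With equal scales e the only collisions are at 4e and 7e, giving A₁₁ - A₀₀ and A₂₂ - A₀₀; these
are forced by v_iᵀu_i = 0. Off-diagonal entries are still isolated. -/
theorem scalar_of_generic_pairing_eq_zero {A : Matrix (Fin 3) (Fin 3) R} {i : Fin 2}
    (h : genericV R i ⬝ᵥ A.map C *ᵥ genericU R i = 0) :
    ∀ a b, A a b = if a = b then A 0 0 else 0 := by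
  rw [generic_pairing] at h
  have hc := fun n => congrArg (fun p => coeff p n) h
  simp only [coeff_add, coeff_C_mul_X_pow, coeff_zero] at hc
  have h0 := hc 0
  have h1 := hc (![1, 10] i)
  have h2 := hc (7 * ![1, 10] i)
  have h3 := hc (3 * ![1, 10] i)
  have h4 := hc (4 * ![1, 10] i)
  have h5 := hc (5 * ![1, 10] i)
  have h6 := hc (10 * ![1, 10] i)
  have h7 := hc (14 * ![1, 10] i)
  clear h hc
  intro a b
  fin_cases i <;> norm_num at h0 h1 h2 h3 h4 h5 h6 h7 <;>
  · rw [neg_add_eq_zero] at h2 h4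
    fin_cases a <;> fin_cases b <;> simp [h0, h1, ← h2, h3, ← h4, h5, h6, h7]

theorem eq_one_of_generic_pairing_eq_zero {t : Rˣ} {g : UB 3} {i : Fin 2}
    (h : genericV R i ⬝ᵥ (burauRep t 1 g).val.map C *ᵥ genericU R i = 0) : burauRep t 1 g = 1 := by
  have hA := scalar_of_generic_pairing_eq_zero h
  have h1 : (burauRep t 1 g).val 0 0 = 1 := by
    rw [← sum_row_burauRep_one t g 0, Finset.sum_congr rfl fun j _ => hA 0 j]
    simp
  ext a b
  rw [hA a b, h1, Units.val_one, Matrix.one_apply]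

end Generic

/-! ### The faithful representation and its specialisation -/

section Representation

variable {L : Type*} [CommRing L] {t : Lˣ}

theorem eq_one_of_burauRep_eq_one_of_map (f : L →+* ℚ) (hf : f t = -2) {g : UB 3}
    (hg : g ∈ braidSubgroup) (h : burauRep t 1 g = 1) : g = 1 := by
  refine eq_one_of_burauRep_eq_one (Units.map f.toMonoidHom t) hf hg ?_
  rw [← map_burauRep_one, h, map_one]

variable (t)

/-- The extended Burau representation for the vectors `u_i`, `v_i` over the polynomials in `z`. -/
noncomputable def genericRep : UB 3 →* GL (Fin 3) L[X][X] :=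
  extendedBurau (Units.map (C : L →+* L[X]).toMonoidHom t) (genericU L) (genericV L)
    genericV_dotProduct_genericU

variable {t}

theorem genericRep_injective [IsDomain L] [CharZero L] (f : L →+* ℚ) (hf : f t = -2) :
    Function.Injective (genericRep t) := by
  have hmap : ∀ g, (burauRep (Units.map (C : L →+* L[X]).toMonoidHom t) 1 g).val =
      (burauRep t 1 g).val.map C := fun g => congrArg Units.val (map_burauRep_one C t g).symm
  refine extendedBurau_injective genericU_ne_zero genericV_ne_zero (fun g hg h => ?_)
    (fun i j g hg hij h => ?_)
  · refine eq_one_of_burauRep_eq_one_of_map f hf hg (Units.ext ?_)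
    refine Matrix.map_injective (C_injective (R := L)) ?_
    exact (hmap g).symm.trans ((congrArg Units.val h).trans (by simp))
  · rw [hmap] at h
    rcases eq_or_ne i j with rfl | hne
    · exact hij rfl (eq_one_of_burauRep_eq_one_of_map f hf hg
        (eq_one_of_generic_pairing_eq_zero h))
    -- A Burau matrix cannot be zero, since its rows sum to 1.
    · have h0 := eq_zero_of_generic_pairing_eq_zero hne h
      have h1 := sum_row_burauRep_one t g 0
      simp [h0] at h1

theorem map_genericRep {S : Type*} [CommRing S] (f : L →+* S) (hf : f t = 1) (g : UB 3) :
    (GeneralLinearGroup.map ((Polynomial.mapRingHom f).comp (Polynomial.evalRingHom 0))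
      (genericRep t g)).val = permMatrixHom (toPerm 3 g) := by
  have ht : Units.map ((Polynomial.mapRingHom f).comp (Polynomial.evalRingHom 0)).toMonoidHom
      (Units.map (C : L[X] →+* L[X][X]).toMonoidHom
        (Units.map (C : L →+* L[X]).toMonoidHom t)) = 1 := by
    ext1
    change Polynomial.mapRingHom f (Polynomial.eval 0 (C (C (t : L)))) = 1
    simp [hf]
  have hU : (fun i => GeneralLinearGroup.map
      ((Polynomial.mapRingHom f).comp (Polynomial.evalRingHom 0))
      (rankOneUnit (genericU L i) (genericV L i) (genericV_dotProduct_genericU i))) = 1 := by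
    ext1 i
    ext a b
    rw [GeneralLinearGroup.map_apply]
    simp [rankOneUnit, Matrix.one_apply, apply_ite]
  rw [← burauRep_one_one, genericRep, extendedBurau, map_burauRep, ht, hU]

theorem congruenceSubgroup_genericRep {S : Type*} [CommRing S] (f : L →+* S) (hf : f t = 1) :
    congruenceSubgroup ((genericRep t).comp (UP 3).subtype)
      (RingHom.ker ((Polynomial.mapRingHom f).comp (Polynomial.evalRingHom 0))) = ⊤ := by
  refine (Subgroup.eq_top_iff' _).2 fun g => ?_
  rw [mem_congruenceSubgroup]
  intro i j
  have hg : toPerm 3 g.1 = 1 := g.2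
  have := congrFun (congrFun (map_genericRep f hf g.1) i) j
  rw [hg, map_one, GeneralLinearGroup.map_apply] at this
  rw [RingHom.mem_ker, map_sub, MonoidHom.comp_apply, Subgroup.subtype_apply, this]
  rcases eq_or_ne i j with rfl | hij
  · rw [one_apply_eq, one_apply_eq, map_one, sub_self]
  · rw [one_apply_ne hij, one_apply_ne hij, map_zero, sub_self]

theorem isResiduallyNilpotent_UP_three [IsDomain L] [CharZero L] [IsNoetherianRing L]
    (f : L →+* ℚ) (hf : f t = -2) (f' : L →+* ℤ) (hf' : f' t = 1) :
    IsResiduallyNilpotent (UP 3) :=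
  isResiduallyNilpotent_of_congruenceSubgroup_eq_top
    (f := (genericRep t).comp (UP 3).subtype)
    ((genericRep_injective f hf).comp (UP 3).subtype_injective)
    (RingHom.ker_ne_top _) (congruenceSubgroup_genericRep f' hf')

end Representation

theorem isLinearGroup_of_injective {G R : Type} [Group G] [CommRing R] [IsDomain R] {n : ℕ}
    (hn : 2 ≤ n) (f : G →* GL (Fin n) R) (hf : Function.Injective f) : IsLinearGroup G := by
  refine ⟨n, FractionRing R, inferInstance, hn,
    (GeneralLinearGroup.map (algebraMap R (FractionRing R))).comp f, ?_⟩
  refine Function.Injective.comp (g := GeneralLinearGroup.map (algebraMap R (FractionRing R)))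
    (fun A B h => ?_) hf
  ext i j
  refine IsFractionRing.injective R (FractionRing R) ?_
  rw [← GeneralLinearGroup.map_apply, h, GeneralLinearGroup.map_apply]

/-! ### The coefficient ring ℤ[t,t⁻¹] -/

section Laurent

open scoped LaurentPolynomial

/-- The Laurent variable as a unit. -/
noncomputable def laurentT : (ℤ[T;T⁻¹])ˣ :=
  ⟨LaurentPolynomial.T 1, LaurentPolynomial.T (-1),
    by rw [← LaurentPolynomial.T_add]; simp, by rw [← LaurentPolynomial.T_add]; simp⟩

theorem eval₂_laurentT {S : Type*} [CommRing S] (f : ℤ →+* S) (x : Sˣ) :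
    LaurentPolynomial.eval₂ f x (laurentT : ℤ[T;T⁻¹]) = x := by
  change LaurentPolynomial.eval₂ f x (LaurentPolynomial.T 1) = x
  simp

instance : IsNoetherianRing ℤ[T;T⁻¹] :=
  IsLocalization.isNoetherianRing (Submonoid.powers (X : ℤ[X])) _ inferInstance

instance : CharZero ℤ[T;T⁻¹] :=
  ⟨fun m n h => by simpa using congrArg (LaurentPolynomial.eval₂ (RingHom.id ℤ) 1) h⟩

end Laurent

end UniversalBraid

theorem mainTheorem9 :
    IsLinearGroup (UniversalBraid.UB 3) ∧ IsResiduallyNilpotent (UniversalBraid.UP 3) := by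
  -- At t = -2 negativity gives the sign pattern, and |t| ≠ 1 keeps the central scalar t³ = -8 of
  -- infinite order; t = 1 turns Burau matrices into permutation matrices.
  have h := UniversalBraid.eval₂_laurentT (Int.castRingHom ℚ) (Units.mk0 (-2) (by norm_num))
  have h' := UniversalBraid.eval₂_laurentT (RingHom.id ℤ) 1
  exact ⟨UniversalBraid.isLinearGroup_of_injective (by norm_num) _ (UniversalBraid.genericRep_injective _ h),
    UniversalBraid.isResiduallyNilpotent_UP_three _ h _ h'⟩
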